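/- Modal formulas are built by $\varphi ::= \bot \mid \top \mid p \mid \neg p \mid \varphi\wedge\varphi \mid \varphi\vee\varphi \mid \Box\varphi \mid \Diamond\varphi$ from countably many propositional variables $p$; negation and implication of arbitrary formulas are defined as usual. $\mathsf{K5}$ (resp. $\mathsf{K45}$) is the smallest normal modal logic $\mathsf K$ extended with the axiom scheme $5:\Diamond\varphi\to\Box\Diamond\varphi$ (resp. with $5$ and $4:\Box\varphi\to\Box\Box\varphi$); its models are the Kripke models $(W,R,V)$ with $W \neq \emptyset$ and $R$ euclidean (resp. euclidean and transitive). A formula $\varphi$ is complete for a logic $l$ if for every formula $\psi$ all of whose variables occur in $\varphi$, $\vdash_l\varphi\to\psi$ or $\vdash_l\varphi\to\neg\psi$. Two pointed models are bisimilar modulo $\emptyset$ if a relation satisfying the forth and back conditions for the accessibility relations (with no condition on the valuations) relates their points. Let $l\in\{\mathsf{K5},\mathsf{K45}\}$. Let $\mathcal M_0$ be the model with a single state, empty accessibility relation and empty valuation, and let $\mathcal M_1$ be the model with a single state that is accessible from itself and empty valuation. 1. $\mathcal M_0$ and $\mathcal M_1$ are models for $l$ that are not bisimilar modulo $\emptyset$.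 Every pointed model $(\mathcal M,a)$ for $l$ is bisimilar modulo $\emptyset$ to $\mathcal M_0$ if and only if no state is accessible from $a$, and to $\mathcal M_1$ if and only if some state is accessible from $a$. Thus, up to bisimulation modulo $\emptyset$, there are exactly two pointed models for $l$. 2. A formula $\varphi$ with no propositional variables is complete for $l$ if and only if it is satisfied in at most one of $\mathcal M_0$ and $\mathcal M_1$. 3. The completeness problem for $l$ restricted to formulas without propositional variables is in $\mathsf P$: the set of strings over a finite alphabet that represent (in prefix notation) a variable-free formula that is complete for $l$ is decided by a deterministic Turing machine in time polynomial in the length of the input string. -/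

import Mathlib

universe u v

namespace ModalCompleteness

/-! ### Modal formulas in negation normal form -/

/-- Formulas of the modal language `L` over the propositional variables `p₀, p₁, …`:
negation is applied to variables only. -/
inductive Formula : Type
  | bot : Formula
  | top : Formula
  | pos : ℕ → Formula
  | neg : ℕ → Formula
  | and : Formula → Formula → Formula
  | or : Formula → Formula → Formula
  | box : Formula → Formula
  | dia : Formula → Formula

namespace Formula

/-- The set `P(φ)` of propositional variables that appear in `φ`. -/
def vars : Formula → Finset ℕ
  | bot => ∅
  | top => ∅
  | pos i => {i}
  | neg i => {i}
  | and φ ψ => φ.vars ∪ ψ.vars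
  | or φ ψ => φ.vars ∪ ψ.vars
  | box φ => φ.vars
  | dia φ => φ.vars

/-- The negation `¬φ` of a formula, obtained by dualizing every connective. -/
def not : Formula → Formula
  | bot => top
  | top => bot
  | pos i => neg i
  | neg i => pos i
  | and φ ψ => or φ.not ψ.not
  | or φ ψ => and φ.not ψ.not
  | box φ => dia φ.not
  | dia φ => box φ.not

/-- The implication `φ → ψ`. -/
def imp (φ ψ : Formula) : Formula := or φ.not ψ

/-- The propositional truth value of a formula when variable `pᵢ` has value `u i` and, as usual for
modal formulas, each `□φ` is treated as an atom with value `b φ`, and `◇φ` as `¬□¬φ`. -/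
def PropEval (u : ℕ → Prop) (b : Formula → Prop) : Formula → Prop
  | bot => False
  | top => True
  | pos i => u i
  | neg i => ¬ u i
  | and φ ψ => φ.PropEval u b ∧ ψ.PropEval u b
  | or φ ψ => φ.PropEval u b ∨ ψ.PropEval u b
  | box φ => b φ
  | dia φ => ¬ b φ.not

/-- Propositional tautologies of the modal language. -/
def IsTautology (φ : Formula) : Prop :=
  ∀ (u : ℕ → Prop) (b : Formula → Prop), φ.PropEval u b

end Formula

/-! ### Modal logics -/

/-- The names of the modal axioms that may be added to the smallest normal modal logic. -/
inductive ModalAxiom : Type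
  | D
  | T
  | four
  | five

open Formula in
/-- The instances of each axiom scheme: `D` is `◇⊤`, `T` is `□φ → φ`, `4` is `□φ → □□φ`, and
`5` is `◇φ → □◇φ`. -/
inductive ModalAxiom.Instance : ModalAxiom → Formula → Prop
  | D : Instance .D (dia top)
  | T (φ : Formula) : Instance .T (imp (box φ) φ)
  | four (φ : Formula) : Instance .four (imp (box φ) (box (box φ)))
  | five (φ : Formula) : Instance .five (imp (dia φ) (box (dia φ)))

/-- A modal logic, given by the set of axioms that are added to the logic `K`. -/
abbrev ModalLogic : Type := Set ModalAxiom

/-- The logic `K5 = K + 5`. -/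
def K5 : ModalLogic := {ModalAxiom.five}

/-- The logic `K45 = K + 4 + 5`. -/
def K45 : ModalLogic := {ModalAxiom.four, ModalAxiom.five}

open Formula in
/-- Derivability `⊢_l φ`: all propositional tautologies, axiom `K`, the axioms of `l`, modus ponens
and necessitation. -/
inductive Provable (l : ModalLogic) : Formula → Prop
  | taut (φ : Formula) : φ.IsTautology → Provable l φ
  | K (φ ψ : Formula) : Provable l (imp (and (box φ) (box (imp φ ψ))) (box ψ))
  | ax (x : ModalAxiom) (φ : Formula) : x ∈ l → x.Instance φ → Provable l φ
  | mp (φ ψ : Formula) : Provable l φ → Provable l (imp φ ψ) → Provable l ψ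
  | nec (φ : Formula) : Provable l φ → Provable l (box φ)

/-- `φ` is complete for `l` when, for each `ψ ∈ L(P(φ))`, the logic `l` derives `φ → ψ` or
`φ → ¬ψ`. -/
def Complete (l : ModalLogic) (φ : Formula) : Prop :=
  ∀ ψ : Formula, ψ.vars ⊆ φ.vars → Provable l (φ.imp ψ) ∨ Provable l (φ.imp ψ.not)

/-! ### Kripke models and bisimulation -/

/-- Kripke models `(W, R, V)`. -/
structure KripkeModel : Type (u + 1) where
  World : Type u
  nonempty : Nonempty World
  Rel : World → World → Prop
  Val : World → Set ℕ

namespace KripkeModel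

/-- Truth of a formula in a state of a Kripke model. -/
def Sat (M : KripkeModel.{u}) : M.World → Formula → Prop
  | _, .bot => False
  | _, .top => True
  | a, .pos i => i ∈ M.Val a
  | a, .neg i => i ∉ M.Val a
  | a, .and φ ψ => M.Sat a φ ∧ M.Sat a ψ
  | a, .or φ ψ => M.Sat a φ ∨ M.Sat a ψ
  | a, .box φ => ∀ b, M.Rel a b → M.Sat b φ
  | a, .dia φ => ∃ b, M.Rel a b ∧ M.Sat b φ

/-- The condition on the accessibility relation that corresponds to a modal axiom: seriality,
reflexivity, transitivity, and euclideanness. -/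
def FrameCondition (M : KripkeModel.{u}) : ModalAxiom → Prop
  | .D => ∀ a, ∃ b, M.Rel a b
  | .T => ∀ a, M.Rel a a
  | .four => ∀ a b c, M.Rel a b → M.Rel b c → M.Rel a c
  | .five => ∀ a b c, M.Rel a b → M.Rel a c → M.Rel b c

/-- `M` is a model for the logic `l`. -/
def IsModelFor (M : KripkeModel.{u}) (l : ModalLogic) : Prop :=
  ∀ x ∈ l, M.FrameCondition x

/-- `Z` is a bisimulation modulo `P` from `M` to `N`. -/
structure IsBisimulation (P : Set ℕ) (M : KripkeModel.{u}) (N : KripkeModel.{v})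
    (Z : M.World → N.World → Prop) : Prop where
  nonempty : ∃ s s', Z s s'
  val : ∀ s s', Z s s' → M.Val s ∩ P = N.Val s' ∩ P
  forth : ∀ s s', Z s s' → ∀ t, M.Rel s t → ∃ t', Z t t' ∧ N.Rel s' t'
  back : ∀ s s', Z s s' → ∀ t', N.Rel s' t' → ∃ t, Z t t' ∧ M.Rel s t

/-- The pointed models `(M, a)` and `(N, b)` are bisimilar modulo `P`. -/
def Bisimilar (P : Set ℕ) (M : KripkeModel.{u}) (a : M.World) (N : KripkeModel.{v})
    (b : N.World) : Prop :=
  ∃ Z : M.World → N.World → Prop, IsBisimulation P M N Z ∧ Z a b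

/-- The model with one state, empty accessibility relation and empty valuation. -/
def irreflexivePoint : KripkeModel.{0} where
  World := Unit
  nonempty := ⟨()⟩
  Rel _ _ := False
  Val _ := ∅

/-- The model with one state that is accessible from itself and with empty valuation. -/
def reflexivePoint : KripkeModel.{0} where
  World := Unit
  nonempty := ⟨()⟩
  Rel _ _ := True
  Val _ := ∅

end KripkeModel

/-! ### Formulas as strings, and the class P -/

/-- The finite alphabet in which formulas are written. -/
inductive Symbol : Type
  | bot
  | top
  | pos
  | neg
  | and
  | or
  | box
  | dia
  | bit (b : Bool)
  deriving DecidableEq, Fintype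

/-- The string that represents a formula, in prefix (Polish) notation; a literal is written as a
symbol for its sign followed by the index of its variable in binary. -/
def Formula.encode : Formula → List Symbol
  | .bot => [.bot]
  | .top => [.top]
  | .pos i => .pos :: (Computability.encodeNat i).map Symbol.bit
  | .neg i => .neg :: (Computability.encodeNat i).map Symbol.bit
  | .and φ ψ => .and :: (φ.encode ++ ψ.encode)
  | .or φ ψ => .or :: (φ.encode ++ ψ.encode)
  | .box φ => .box :: φ.encode
  | .dia φ => .dia :: φ.encode

/-- The completeness problem for `l` restricted to formulas without propositional variables, as a
set of strings: the representations of the variable-free formulas that are complete for `l`. -/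
def variableFreeCompleteness (l : ModalLogic) : Language Symbol :=
  {w | ∃ φ : Formula, φ.vars = ∅ ∧ Complete l φ ∧ φ.encode = w}

/-- The class P: `A` is decided by a deterministic Turing machine (with finitely many stacks, each
over a finite alphabet) that, on every input string `w`, halts within a number of steps that is
bounded by a polynomial in the length of `w` and outputs whether `w ∈ A`. -/
def InP {Γ : Type} [Fintype Γ] (A : Language Γ) : Prop :=
  ∃ f : List Γ → Bool, (∀ w, f w = true ↔ w ∈ A) ∧
    ∃ c : Turing.TM2ComputableInPolyTime (id : List Γ → List Γ) Computability.encodeBool f,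
      ∀ k, Finite (c.tm.Γ k)

end ModalCompleteness

open ModalCompleteness ModalCompleteness.KripkeModel

/-! Euclideanness makes every successor reflexive, so having a successor is preserved along
accessibility. Modulo `∅` only that property matters: the dead ends form one bisimulation class, and
all other states form the other. The syntactic counterpart is that `□⊥` derives every variable-free
formula true in the irreflexive point (`provable_of_irreflexivePoint_sat`), and that with axiom 5
`◇⊤` derives every one true in the reflexive point (`provable_of_reflexivePoint_sat`). If `φ` fails
in one point, it therefore implies `◇⊤` or `□⊥`, and either decides every variable-free `ψ`. If `φ`
holds in both, soundness shows that it does not decide `◇⊤`. No general completeness theorem is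
needed. Membership in P then amounts to evaluating `φ` in both points at once. Prefix notation read
from the right is postfix notation, so a stack of pairs of truth values suffices, and a machine does
this in linear time. -/

namespace ModalCompleteness

/-! ### Propositional reasoning -/

namespace Formula

theorem not_not (φ : Formula) : φ.not.not = φ := by
  induction φ <;> simp_all [Formula.not]

theorem propEval_not (u : ℕ → Prop) (b : Formula → Prop) (φ : Formula) :
    φ.not.PropEval u b ↔ ¬ φ.PropEval u b := by
  induction φ <;> simp_all [Formula.not, PropEval, not_not, imp_iff_not_or]

theorem propEval_imp (u : ℕ → Prop) (b : Formula → Prop) (φ ψ : Formula) :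
    (φ.imp ψ).PropEval u b ↔ (φ.PropEval u b → ψ.PropEval u b) := by
  simp [imp, PropEval, propEval_not, imp_iff_not_or]

theorem vars_not (φ : Formula) : φ.not.vars = φ.vars := by
  induction φ <;> simp_all [Formula.not, vars]

end Formula

open Formula KripkeModel

/-! ### Truth in Kripke models and soundness. -/

namespace KripkeModel

theorem sat_not (M : KripkeModel.{u}) (φ : Formula) (a : M.World) :
    M.Sat a φ.not ↔ ¬ M.Sat a φ := by
  induction φ generalizing a <;> simp_all [Formula.not, Sat, imp_iff_not_or]

theorem sat_imp (M : KripkeModel.{u}) (φ ψ : Formula) (a : M.World) :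
    M.Sat a (φ.imp ψ) ↔ (M.Sat a φ → M.Sat a ψ) := by
  simp [imp, Sat, sat_not, imp_iff_not_or]

theorem propEval_iff_sat (M : KripkeModel.{u}) (a : M.World) (φ : Formula) :
    φ.PropEval (· ∈ M.Val a) (fun ψ => M.Sat a (box ψ)) ↔ M.Sat a φ := by
  induction φ <;> simp_all [PropEval, Sat, sat_not]

end KripkeModel

/-- Soundness of derivability with respect to Kripke models. -/
theorem Provable.sound {l : ModalLogic} {φ : Formula} (h : Provable l φ) {M : KripkeModel.{u}}
    (hM : M.IsModelFor l) (a : M.World) : M.Sat a φ := by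
  induction h generalizing a with
  | taut φ hφ => exact (M.propEval_iff_sat a φ).1 (hφ _ _)
  | K φ ψ =>
    simp only [sat_imp, Sat]
    exact fun h b hb => h.2 b hb (h.1 b hb)
  | ax x φ hx hφ =>
    have hF := hM x hx
    cases hφ with
    | D => exact (hF a).imp fun b hb => ⟨hb, trivial⟩
    | T φ => exact (sat_imp _ _ _ _).2 fun h => h a (hF a)
    | four φ => exact (sat_imp _ _ _ _).2 fun h b hb c hc => h c (hF a b c hb hc)
    | five φ =>
      refine (sat_imp _ _ _ _).2 ?_
      rintro ⟨c, hc, h⟩ b hb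
      exact ⟨c, hF a b c hb hc, h⟩
  | mp φ ψ _ _ ih₁ ih₂ => exact (sat_imp _ _ _ _).1 (ih₂ a) (ih₁ a)
  | nec φ _ ih => exact fun b _ => ih b

/-! ### Derived rules. -/

namespace Provable

variable {l : ModalLogic} {φ ψ χ : Formula}

theorem of_taut₁ (h₁ : Provable l φ)
    (h : ∀ u b, φ.PropEval u b → χ.PropEval u b) : Provable l χ :=
  .mp _ _ h₁ (.taut _ fun u b => (propEval_imp u b _ _).2 (h u b))

theorem of_taut₂ (h₁ : Provable l φ) (h₂ : Provable l ψ)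
    (h : ∀ u b, φ.PropEval u b → ψ.PropEval u b → χ.PropEval u b) : Provable l χ :=
  .mp _ _ h₂ (h₁.of_taut₁ fun u b hφ => (propEval_imp u b _ _).2 (h u b hφ))

theorem imp_trans (h₁ : Provable l (φ.imp ψ)) (h₂ : Provable l (ψ.imp χ)) :
    Provable l (φ.imp χ) :=
  h₁.of_taut₂ h₂ fun u b => by simp only [propEval_imp]; tauto

theorem box_mono (h : Provable l (φ.imp ψ)) : Provable l ((box φ).imp (box ψ)) :=
  (Provable.nec _ h).of_taut₂ (.K φ ψ) fun u b => by
    simp only [propEval_imp, PropEval]; tauto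

/-- `◇⊤ ∧ □φ → ◇φ`. -/
theorem dia_of_box (l : ModalLogic) (φ : Formula) :
    Provable l ((dia top).imp ((box φ).imp (dia φ))) := by
  -- Boxing this and applying `K` gives `□φ ∧ □¬φ → □⊥`; the goal is its contrapositive.
  have h₁ : Provable l (φ.imp (φ.not.imp bot)) := .taut _ fun u b => by
    simp only [propEval_imp, propEval_not, PropEval]; tauto
  refine h₁.box_mono.of_taut₂ (.K φ.not bot) fun u b => ?_
  simp only [propEval_imp, PropEval, Formula.not]; tauto

end Provable

/-! ### The theories of `□⊥` and `◇⊤`, and the completeness criterion. -/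

theorem five_mem {l : ModalLogic} (hl : l = K5 ∨ l = K45) : ModalAxiom.five ∈ l := by
  rcases hl with rfl | rfl <;> simp [K5, K45]

/-- A variable-free formula true in the irreflexive point follows from `□⊥`. -/
theorem provable_of_irreflexivePoint_sat (l : ModalLogic) {φ : Formula} (hφ : φ.vars = ∅)
    (h : irreflexivePoint.Sat () φ) : Provable l ((box bot).imp φ) := by
  induction φ with
  | bot => exact h.elim
  | top => exact .taut _ fun u b => by simp [propEval_imp, PropEval]
  | pos i => simp [vars] at hφ
  | neg i => simp [vars] at hφ
  | and φ ψ ih₁ ih₂ =>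
    simp only [vars, Finset.union_eq_empty] at hφ
    exact (ih₁ hφ.1 h.1).of_taut₂ (ih₂ hφ.2 h.2) fun u b => by
      simp only [propEval_imp, PropEval]; tauto
  | or φ ψ ih₁ ih₂ =>
    simp only [vars, Finset.union_eq_empty] at hφ
    rcases h with h | h
    · exact (ih₁ hφ.1 h).of_taut₁ fun u b => by simp only [propEval_imp, PropEval]; tauto
    · exact (ih₂ hφ.2 h).of_taut₁ fun u b => by simp only [propEval_imp, PropEval]; tauto
  | box φ _ =>
    exact Provable.box_mono (.taut _ fun u b => by simp [propEval_imp, PropEval])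
  | dia φ _ => exact h.elim fun _ hb => hb.1.elim

/-- With axiom 5, a variable-free formula true in the reflexive point follows from `◇⊤`. -/
theorem provable_of_reflexivePoint_sat {l : ModalLogic} (hl : ModalAxiom.five ∈ l) {φ : Formula}
    (hφ : φ.vars = ∅) (h : reflexivePoint.Sat () φ) : Provable l ((dia top).imp φ) := by
  have h5 : Provable l ((dia top).imp (box (dia top))) := .ax _ _ hl (.five top)
  induction φ with
  | bot => exact h.elim
  | top => exact .taut _ fun u b => by simp [propEval_imp, PropEval]
  | pos i => simp [vars] at hφ
  | neg i => simp [vars] at hφ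
  | and φ ψ ih₁ ih₂ =>
    simp only [vars, Finset.union_eq_empty] at hφ
    exact (ih₁ hφ.1 h.1).of_taut₂ (ih₂ hφ.2 h.2) fun u b => by
      simp only [propEval_imp, PropEval]; tauto
  | or φ ψ ih₁ ih₂ =>
    simp only [vars, Finset.union_eq_empty] at hφ
    rcases h with h | h
    · exact (ih₁ hφ.1 h).of_taut₁ fun u b => by simp only [propEval_imp, PropEval]; tauto
    · exact (ih₂ hφ.2 h).of_taut₁ fun u b => by simp only [propEval_imp, PropEval]; tauto
  -- Axiom 5 carries `◇⊤` under the box, where the induction hypothesis applies.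
  | box φ ih => exact h5.imp_trans (ih hφ (h () trivial)).box_mono
  | dia φ ih =>
    obtain ⟨_, _, hs⟩ := h
    exact (h5.imp_trans (ih hφ hs).box_mono).of_taut₂ (.dia_of_box l φ) fun u b => by
      simp only [propEval_imp]; tauto

theorem irreflexivePoint_isModelFor (hl : l = K5 ∨ l = K45) : irreflexivePoint.IsModelFor l := by
  rcases hl with rfl | rfl <;> rintro x hx <;>
    simp only [K5, K45, Set.mem_singleton_iff, Set.mem_insert_iff] at hx <;>
    rcases hx with rfl | rfl <;> simp [FrameCondition, irreflexivePoint]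

theorem reflexivePoint_isModelFor (hl : l = K5 ∨ l = K45) : reflexivePoint.IsModelFor l := by
  rcases hl with rfl | rfl <;> rintro x hx <;>
    simp only [K5, K45, Set.mem_singleton_iff, Set.mem_insert_iff] at hx <;>
    rcases hx with rfl | rfl <;> simp [FrameCondition, reflexivePoint]

/-- A variable-free formula is complete for `K5` or `K45` if and only if it is true in at most one
of the two one-point models. -/
theorem complete_iff_of_vars_eq_empty {l : ModalLogic} (hl : l = K5 ∨ l = K45) {φ : Formula}
    (hφ : φ.vars = ∅) :
    Complete l φ ↔ ¬ (irreflexivePoint.Sat () φ ∧ reflexivePoint.Sat () φ) := by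
  constructor
  · rintro h ⟨h₀, h₁⟩
    -- `◇⊤` separates the two points, so `φ` can imply neither it nor its negation.
    rcases h (dia top) (by simp [vars]) with h | h
    · obtain ⟨_, hb, _⟩ := (sat_imp _ _ _ _).1 (h.sound (irreflexivePoint_isModelFor hl) ()) h₀
      exact hb
    · exact (sat_imp _ _ _ _).1 (h.sound (reflexivePoint_isModelFor hl) ()) h₁ () trivial
  · intro h ψ hψ
    rw [hφ, Finset.subset_empty] at hψ
    rcases not_and_or.1 h with h | h
    · have hn := provable_of_irreflexivePoint_sat l ((vars_not φ).trans hφ) ((sat_not _ _ _).2 h)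
      have key : ∀ {χ : Formula}, χ.vars = ∅ → reflexivePoint.Sat () χ →
          Provable l (φ.imp χ) := fun hχ hs =>
        hn.of_taut₂ (provable_of_reflexivePoint_sat (five_mem hl) hχ hs) fun u b => by
          simp only [propEval_imp, propEval_not, PropEval, Formula.not]; tauto
      by_cases hs : reflexivePoint.Sat () ψ
      · exact .inl (key hψ hs)
      · exact .inr (key ((vars_not ψ).trans hψ) ((sat_not _ _ _).2 hs))
    · have hn := provable_of_reflexivePoint_sat (five_mem hl) ((vars_not φ).trans hφ)
        ((sat_not _ _ _).2 h)
      have key : ∀ {χ : Formula}, χ.vars = ∅ → irreflexivePoint.Sat () χ →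
          Provable l (φ.imp χ) := fun hχ hs =>
        hn.of_taut₂ (provable_of_irreflexivePoint_sat l hχ hs) fun u b => by
          simp only [propEval_imp, propEval_not, PropEval, Formula.not]; tauto
      by_cases hs : irreflexivePoint.Sat () ψ
      · exact .inl (key hψ hs)
      · exact .inr (key ((vars_not ψ).trans hψ) ((sat_not _ _ _).2 hs))

/-! ### Bisimilarity modulo the empty set -/

theorem bisimilar_irreflexivePoint_iff (M : KripkeModel.{u}) (a : M.World) :
    Bisimilar ∅ M a irreflexivePoint () ↔ ¬ ∃ b, M.Rel a b := by
  constructor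
  · rintro ⟨Z, hZ, ha⟩ ⟨b, hb⟩
    obtain ⟨_, _, h⟩ := hZ.forth _ _ ha b hb
    exact h
  · intro h
    refine ⟨fun s _ => ¬ ∃ b, M.Rel s b, ⟨⟨a, (), h⟩, by simp, ?_, ?_⟩, h⟩
    · exact fun s _ hs t ht => (hs ⟨t, ht⟩).elim
    · exact fun _ _ _ _ ht => ht.elim

theorem bisimilar_reflexivePoint_iff {M : KripkeModel.{u}} (hM : M.FrameCondition .five)
    (a : M.World) : Bisimilar ∅ M a reflexivePoint () ↔ ∃ b, M.Rel a b := by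
  constructor
  · rintro ⟨Z, hZ, ha⟩
    obtain ⟨t, _, h⟩ := hZ.back _ _ ha () trivial
    exact ⟨t, h⟩
  · intro h
    refine ⟨fun s _ => ∃ b, M.Rel s b, ⟨⟨a, (), h⟩, by simp, ?_, ?_⟩, h⟩
    -- Euclideanness applied to the same successor twice gives `M.Rel t t`.
    · exact fun s _ _ t ht => ⟨(), ⟨t, hM s t t ht ht⟩, trivial⟩
    · rintro s _ ⟨t, ht⟩ _ _
      exact ⟨t, ⟨t, hM s t t ht ht⟩, ht⟩

/-! ### Evaluation of variable-free formulas on a stack -/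

/-- The truth values of a formula in the two one-point models, if it has no variables. -/
def Formula.value : Formula → Option (Bool × Bool)
  | bot => some (false, false)
  | top => some (true, true)
  | pos _ => none
  | neg _ => none
  | and φ ψ => Option.map₂ (fun x y => (x.1 && y.1, x.2 && y.2)) φ.value ψ.value
  | or φ ψ => Option.map₂ (fun x y => (x.1 || y.1, x.2 || y.2)) φ.value ψ.value
  | box φ => φ.value.map fun x => (true, x.2)
  | dia φ => φ.value.map fun x => (false, x.2)

theorem Formula.value_spec {φ : Formula} {x : Bool × Bool} (h : φ.value = some x) :
    φ.vars = ∅ ∧ (x.1 = true ↔ irreflexivePoint.Sat () φ) ∧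
      (x.2 = true ↔ reflexivePoint.Sat () φ) := by
  induction φ generalizing x with
  | bot => cases h; simp [vars, Sat]
  | top => cases h; simp [vars, Sat]
  | pos i => cases h
  | neg i => cases h
  | and φ ψ ih₁ ih₂ | or φ ψ ih₁ ih₂ =>
    obtain ⟨y, z, hy, hz, rfl⟩ := Option.map₂_eq_some_iff.1 h
    simp [vars, Sat, ih₁ hy, ih₂ hz]
  | box φ ih =>
    obtain ⟨y, hy, rfl⟩ := Option.map_eq_some_iff.1 h
    obtain ⟨hv, _, hr⟩ := ih hy
    exact ⟨hv, by simp [Sat, irreflexivePoint], hr.trans ⟨fun h _ _ => h, fun h => h () trivial⟩⟩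
  | dia φ ih =>
    obtain ⟨y, hy, rfl⟩ := Option.map_eq_some_iff.1 h
    obtain ⟨hv, _, hr⟩ := ih hy
    exact ⟨hv, by simp [Sat, irreflexivePoint],
      hr.trans ⟨fun h => ⟨(), trivial, h⟩, fun ⟨_, _, h⟩ => h⟩⟩

theorem Formula.exists_value {φ : Formula} (h : φ.vars = ∅) : ∃ x, φ.value = some x := by
  induction φ with
  | bot => exact ⟨_, rfl⟩
  | top => exact ⟨_, rfl⟩
  | pos i => simp [vars] at h
  | neg i => simp [vars] at h
  | and φ ψ ih₁ ih₂ | or φ ψ ih₁ ih₂ =>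
    simp only [vars, Finset.union_eq_empty] at h
    obtain ⟨x, hx⟩ := ih₁ h.1
    obtain ⟨y, hy⟩ := ih₂ h.2
    simp [value, hx, hy]
  | box φ ih | dia φ ih =>
    obtain ⟨x, hx⟩ := ih h
    simp [value, hx]

/-! ### Evaluation of strings from right to left. -/

namespace Symbol

/-- Whether the symbol is a unary connective. -/
def isUnary : Symbol → Bool
  | box | dia => true
  | _ => false

/-- Whether the symbol is a binary connective. -/
def isBinary : Symbol → Bool
  | and | or => true
  | _ => false

/-- The operation on truth values in the two one-point models that a symbol denotes; the symbols
that occur in literals denote the undefined value, and superfluous arguments are ignored. -/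
def operation (x y : Option (Bool × Bool)) : Symbol → Option (Bool × Bool)
  | bot => some (false, false)
  | top => some (true, true)
  | and => Option.map₂ (fun x y => (x.1 && y.1, x.2 && y.2)) x y
  | or => Option.map₂ (fun x y => (x.1 || y.1, x.2 || y.2)) x y
  | box => x.map fun x => (true, x.2)
  | dia => x.map fun x => (false, x.2)
  | _ => none

/-- Replace the arguments of a symbol, which are on top of the stack, by its value. -/
def apply (s : Symbol) (S : List (Option (Bool × Bool))) : List (Option (Bool × Bool)) :=
  if s.isBinary then s.operation S.head?.join S.tail.head?.join :: S.tail.tail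
  else if s.isUnary then s.operation S.head?.join none :: S.tail
  else s.operation none none :: S

theorem length_apply_le (s : Symbol) (S : List (Option (Bool × Bool))) :
    (s.apply S).length ≤ S.length + 1 := by
  unfold apply
  split_ifs <;> (simp; try omega)

end Symbol

/-- The stack after a string has been evaluated from right to left. -/
def evalStack (w : List Symbol) : List (Option (Bool × Bool)) := w.foldr Symbol.apply []

/-- The stack below is arbitrary so that the first argument of a binary connective can be evaluated
on top of the value of the second. -/
theorem foldr_apply_encode {φ : Formula} (h : φ.vars = ∅) (S : List (Option (Bool × Bool))) :
    φ.encode.foldr Symbol.apply S = φ.value :: S := by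
  induction φ generalizing S with
  | bot | top => rfl
  | pos i => simp [vars] at h
  | neg i => simp [vars] at h
  | and φ ψ ih₁ ih₂ | or φ ψ ih₁ ih₂ =>
    simp only [vars, Finset.union_eq_empty] at h
    simp [encode, ih₁ h.1, ih₂ h.2, Symbol.apply, Symbol.isBinary, Symbol.operation, value]
  | box φ ih | dia φ ih =>
    simp [encode, ih h, Symbol.apply, Symbol.isBinary, Symbol.isUnary, Symbol.operation, value]

/-- Missing arguments and literal symbols produce `none`, and an operation that consumes `none`
returns `none`, so errors are never erased. A list of formulas is needed because a suffix of an
encoding may encode several formulas. -/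
theorem exists_formulas_of_evalStack {w : List Symbol} {L : List (Bool × Bool)}
    (h : evalStack w = L.map some) :
    ∃ Φ : List Formula, Φ.map value = L.map some ∧ Φ.flatMap encode = w := by
  induction w generalizing L with
  | nil => exact ⟨[], by simpa [evalStack] using h, rfl⟩
  | cons s w ih =>
    have h' : s.apply (evalStack w) = L.map some := h
    cases s with
    | bot =>
      obtain _ | ⟨x, L⟩ := L
      · simp [Symbol.apply, Symbol.isBinary, Symbol.isUnary] at h'
      simp only [Symbol.apply, Symbol.isBinary, Symbol.isUnary, Symbol.operation, List.map_cons,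
        List.cons.injEq, Bool.false_eq_true, if_false] at h'
      obtain ⟨Φ, h₁, h₂⟩ := ih h'.2
      exact ⟨.bot :: Φ, by simp [h₁, value, h'.1], by simp [h₂, encode]⟩
    | top =>
      obtain _ | ⟨x, L⟩ := L
      · simp [Symbol.apply, Symbol.isBinary, Symbol.isUnary] at h'
      simp only [Symbol.apply, Symbol.isBinary, Symbol.isUnary, Symbol.operation, List.map_cons,
        List.cons.injEq, Bool.false_eq_true, if_false] at h'
      obtain ⟨Φ, h₁, h₂⟩ := ih h'.2
      exact ⟨.top :: Φ, by simp [h₁, value, h'.1], by simp [h₂, encode]⟩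
    | pos | neg | bit =>
      cases L <;> simp [Symbol.apply, Symbol.isBinary, Symbol.isUnary, Symbol.operation] at h'
    | and | or =>
      obtain _ | ⟨x, L⟩ := L
      · simp [Symbol.apply, Symbol.isBinary] at h'
      simp only [Symbol.apply, Symbol.isBinary, Symbol.operation, List.map_cons,
        List.cons.injEq, if_true] at h'
      obtain ⟨hx, hL⟩ := h'
      obtain ⟨y, z, hy, hz, hyz⟩ := Option.map₂_eq_some_iff.1 hx
      -- A missing entry would have been read as `none`, so both arguments really are on the stack.
      have hS : evalStack w = (y :: z :: L).map some := by
        generalize evalStack w = S at *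
        obtain _ | ⟨_, _ | ⟨_, S⟩⟩ := S <;> simp_all
      obtain ⟨Φ, h₁, h₂⟩ := ih hS
      obtain _ | ⟨φ, _ | ⟨ψ, Φ⟩⟩ := Φ
      · simp at h₁
      · simp at h₁
      simp only [List.map_cons, List.cons.injEq] at h₁
      first
        | (refine ⟨.and φ ψ :: Φ, ?_, ?_⟩ <;> simp [h₁, value, ← hyz, ← h₂, encode]; done)
        | (refine ⟨.or φ ψ :: Φ, ?_, ?_⟩ <;> simp [h₁, value, ← hyz, ← h₂, encode])
    | box | dia =>
      obtain _ | ⟨x, L⟩ := L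
      · simp [Symbol.apply, Symbol.isBinary, Symbol.isUnary] at h'
      simp only [Symbol.apply, Symbol.isBinary, Symbol.isUnary, Symbol.operation, List.map_cons,
        List.cons.injEq, if_true, Bool.false_eq_true, if_false] at h'
      obtain ⟨hx, hL⟩ := h'
      obtain ⟨y, hy, hxy⟩ := Option.map_eq_some_iff.1 hx
      have hS : evalStack w = (y :: L).map some := by
        generalize evalStack w = S at *
        obtain _ | ⟨_, S⟩ := S <;> simp_all
      obtain ⟨Φ, h₁, h₂⟩ := ih hS
      obtain _ | ⟨φ, Φ⟩ := Φ
      · simp at h₁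
      simp only [List.map_cons, List.cons.injEq] at h₁
      first
        | (refine ⟨.box φ :: Φ, ?_, ?_⟩ <;> simp [h₁, value, ← hxy, ← h₂, encode]; done)
        | (refine ⟨.dia φ :: Φ, ?_, ?_⟩ <;> simp [h₁, value, ← hxy, ← h₂, encode])

/-- Whether the two topmost entries show that the stack consists of the value of a formula that is
true in at most one of the one-point models. -/
def accepts : Option (Option (Bool × Bool)) → Option (Option (Bool × Bool)) → Bool
  | some (some x), none => decide ¬ (x.1 = true ∧ x.2 = true)
  | _, _ => false

/-- Decides whether a string represents a variable-free formula that is complete. -/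
def decideComplete (w : List Symbol) : Bool :=
  accepts (evalStack w).head? (evalStack w).tail.head?

/-- Unique readability is not needed: every variable-free formula encoded by `w` evaluates to the
single stack entry. -/
theorem decideComplete_iff {l : ModalLogic} (hl : l = K5 ∨ l = K45) (w : List Symbol) :
    decideComplete w = true ↔ w ∈ variableFreeCompleteness l := by
  constructor
  · intro h
    have : ∃ x : Bool × Bool, evalStack w = [x].map some ∧ ¬ (x.1 = true ∧ x.2 = true) := by
      unfold decideComplete at h
      generalize evalStack w = S at *
      obtain _ | ⟨_ | x, _ | ⟨y, S⟩⟩ := S <;> simp [accepts] at h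
      exact ⟨x, rfl, by simpa [imp_iff_not_or] using h⟩
    obtain ⟨x, hx, hn⟩ := this
    obtain ⟨Φ, h₁, h₂⟩ := exists_formulas_of_evalStack hx
    obtain ⟨φ, rfl, hφ⟩ : ∃ φ, Φ = [φ] ∧ φ.value = some x := by
      obtain _ | ⟨φ, _ | ⟨ψ, Φ⟩⟩ := Φ <;> simp at h₁
      exact ⟨φ, rfl, h₁⟩
    obtain ⟨hv, hi, hr⟩ := value_spec hφ
    refine ⟨φ, hv, (complete_iff_of_vars_eq_empty hl hv).2 ?_, by simpa using h₂⟩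
    rwa [← hi, ← hr]
  · rintro ⟨φ, hv, hc, rfl⟩
    obtain ⟨x, hx⟩ := exists_value hv
    obtain ⟨_, hi, hr⟩ := value_spec hx
    rw [complete_iff_of_vars_eq_empty hl hv, ← hi, ← hr] at hc
    simpa [decideComplete, evalStack, foldr_apply_encode hv, hx, accepts, imp_iff_not_or] using hc

end ModalCompleteness

namespace ModalCompleteness

/-! ### A stack machine that decides completeness of variable-free formulas -/

open Turing

namespace CompletenessMachine

/-- The stacks of the machine. -/
inductive Stack : Type
  | input
  | reversed
  | values
  | output
  deriving DecidableEq

instance : Fintype Stack :=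
  ⟨{.input, .reversed, .values, .output}, fun k => by cases k <;> decide⟩

/-- The labels of the machine: it reverses the input, evaluates it, writes its answer, and empties
the stack of values. -/
inductive Label : Type
  | reverse
  | eval
  | answer
  | clear
  deriving DecidableEq

instance : Fintype Label :=
  ⟨{.reverse, .eval, .answer, .clear}, fun q => by cases q <;> decide⟩

/-- The alphabets of the stacks. -/
abbrev Alphabet : Stack → Type
  | .input => Symbol
  | .reversed => Symbol
  | .values => Option (Bool × Bool)
  | .output => Bool

/-- The registers: the current symbol and up to two entries of the stack of values. -/
abbrev Registers : Type :=
  Option Symbol × Option (Option (Bool × Bool)) × Option (Option (Bool × Bool))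

/-- The value of the symbol in the first register applied to the values in the other registers. -/
def Registers.result (v : Registers) : Option (Bool × Bool) :=
  (v.1.getD .bot).operation v.2.1.join v.2.2.join

open TM2.Stmt in
/-- The program of the machine. -/
def program : Label → TM2.Stmt Alphabet Label Registers
  | .reverse =>
    pop .input (fun _ x => (x, none, none)) <|
      branch (fun v => v.1.isSome)
        (push .reversed (fun v => v.1.getD .bot) <| goto fun _ => .reverse)
        (goto fun _ => .eval)
  | .eval =>
    pop .reversed (fun _ x => (x, none, none)) <|
      branch (fun v => v.1.isSome)
        (branch (fun v => (v.1.getD .bot).isBinary)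
          (pop .values (fun v x => (v.1, x, none)) <|
            pop .values (fun v x => (v.1, v.2.1, x)) <|
              push .values Registers.result <| goto fun _ => .eval)
          (branch (fun v => (v.1.getD .bot).isUnary)
            (pop .values (fun v x => (v.1, x, none)) <|
              push .values Registers.result <| goto fun _ => .eval)
            (push .values Registers.result <| goto fun _ => .eval)))
        (goto fun _ => .answer)
  | .answer =>
    pop .values (fun v x => (v.1, x, none)) <|
      pop .values (fun v x => (v.1, v.2.1, x)) <|
        push .output (fun v => accepts v.2.1 v.2.2) <| goto fun _ => .clear
  | .clear =>
    pop .values (fun _ x => (none, x, none)) <|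
      branch (fun v => v.2.1.isSome) (goto fun _ => .clear) halt

/-- The machine. -/
def machine : FinTM2 where
  K := Stack
  k₀ := .input
  k₁ := .output
  Γ := Alphabet
  Λ := Label
  main := .reverse
  σ := Registers
  initialState := (none, none, none)
  Γk₀Fin := inferInstanceAs (Fintype Symbol)
  m := program

/-- The contents of all stacks. -/
def contents (i r : List Symbol) (S : List (Option (Bool × Bool))) (o : List Bool) :
    ∀ k, List (Alphabet k)
  | .input => i
  | .reversed => r
  | .values => S
  | .output => o

/-! ### Runs of the machine and their length. -/

section Updates

variable (i r : List Symbol) (S : List (Option (Bool × Bool))) (o : List Bool)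

@[simp]
theorem update_input (i') :
    Function.update (contents i r S o) .input i' = contents i' r S o := by
  funext k; cases k <;> rfl

@[simp]
theorem update_reversed (r') :
    Function.update (contents i r S o) .reversed r' = contents i r' S o := by
  funext k; cases k <;> rfl

@[simp]
theorem update_values (S') :
    Function.update (contents i r S o) .values S' = contents i r S' o := by
  funext k; cases k <;> rfl

@[simp]
theorem update_output (o') :
    Function.update (contents i r S o) .output o' = contents i r S o' := by
  funext k; cases k <;> rfl

@[simp] theorem contents_input : contents i r S o .input = i := rfl
@[simp] theorem contents_reversed : contents i r S o .reversed = r := rfl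
@[simp] theorem contents_values : contents i r S o .values = S := rfl
@[simp] theorem contents_output : contents i r S o .output = o := rfl

end Updates

/-- The result of running the machine for `n` steps. -/
def run (n : ℕ) (c : Option (TM2.Cfg Alphabet Label Registers)) :
    Option (TM2.Cfg Alphabet Label Registers) :=
  -- This is the iteration that appears in `Turing.EvalsTo`.
  (flip bind (TM2.step program))^[n] c

theorem run_succ (n : ℕ) (q : Label) (v : Registers) (T : ∀ k, List (Alphabet k)) :
    run (n + 1) (some ⟨some q, v, T⟩) = run n (some (TM2.stepAux (program q) v T)) := rfl

theorem run_add (m n : ℕ) (c) : run (m + n) c = run n (run m c) := by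
  rw [add_comm]
  exact Function.iterate_add_apply _ _ _ _

/-- The extra step is the pop of the empty stack, which resets the registers and changes the label.
-/
theorem run_reverse (w r : List Symbol) (v : Registers) :
    run (w.length + 1) (some ⟨some .reverse, v, contents w r [] []⟩) =
      some ⟨some .eval, (none, none, none), contents [] (w.reverse ++ r) [] []⟩ := by
  induction w generalizing r v with
  | nil => simp [run_succ, program]; rfl
  | cons s w ih =>
    rw [List.length_cons, run_succ]
    simp [program, ih]

/-- One step executes the whole statement at a label, hence processes a whole symbol. The registers
left behind are irrelevant, since the next pop overwrites them. -/
theorem stepAux_eval_cons (s : Symbol) (r : List Symbol) (S : List (Option (Bool × Bool)))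
    (v : Registers) :
    ∃ v', TM2.stepAux (program .eval) v (contents [] (s :: r) S []) =
      ⟨some .eval, v', contents [] r (s.apply S) []⟩ := by
  refine ⟨if s.isBinary then (some s, S.head?, S.tail.head?)
    else if s.isUnary then (some s, S.head?, none) else (some s, none, none), ?_⟩
  by_cases hb : s.isBinary = true
  · simp [program, Registers.result, Symbol.apply, hb]
  · by_cases hu : s.isUnary = true <;>
      simp [program, Registers.result, Symbol.apply, hb, hu]

theorem run_eval (r : List Symbol) (S : List (Option (Bool × Bool))) (v : Registers) :
    run (r.length + 1) (some ⟨some .eval, v, contents [] r S []⟩) =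
      some ⟨some .answer, (none, none, none),
        contents [] [] (r.foldl (fun S s => s.apply S) S) []⟩ := by
  induction r generalizing S v with
  | nil => simp [run_succ, program]; rfl
  | cons s r ih =>
    obtain ⟨v', hv'⟩ := stepAux_eval_cons s r S v
    rw [List.length_cons, run_succ, hv', ih, List.foldl_cons]

theorem run_clear (S : List (Option (Bool × Bool))) (o : List Bool) (v : Registers) :
    run (S.length + 1) (some ⟨some .clear, v, contents [] [] S o⟩) =
      some ⟨none, (none, none, none), contents [] [] [] o⟩ := by
  induction S generalizing v with
  | nil => simp [run_succ, program]; rfl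
  | cons x S ih =>
    rw [List.length_cons, run_succ]
    simp [program, ih]

theorem length_evalStack_le (w : List Symbol) : (evalStack w).length ≤ w.length := by
  induction w with
  | nil => simp [evalStack]
  | cons s w ih => exact (s.length_apply_le _).trans (Nat.succ_le_succ ih)

theorem exists_run (w : List Symbol) (v : Registers) :
    ∃ n ≤ 3 * w.length + 4, run n (some ⟨some .reverse, v, contents w [] [] []⟩) =
      some ⟨none, (none, none, none), contents [] [] [] [decideComplete w]⟩ := by
  -- The summands count reversing, evaluating, answering, and clearing what remains after the answer
  -- pops up to two values. Clearing is required because `haltList` demands that all stacks but the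
  -- output be empty.
  refine ⟨(w.length + 1) + ((w.reverse.length + 1) +
    (1 + ((evalStack w).tail.tail.length + 1))), ?_, ?_⟩
  · have := length_evalStack_le w
    simp only [List.length_reverse, List.length_tail]
    omega
  · rw [run_add, run_reverse, List.append_nil, run_add, run_eval, List.foldl_reverse, run_add,
      run_succ]
    simp only [program, TM2.stepAux, update_values, update_output, contents_values, contents_output]
    exact run_clear _ _ _

/-- The machine decides completeness of variable-free formulas in linear time. -/
noncomputable def computable :
    TM2ComputableInPolyTime (id : List Symbol → List Symbol) Computability.encodeBool
      decideComplete where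
  tm := machine
  inputAlphabet := Equiv.refl Symbol
  outputAlphabet := Equiv.refl Bool
  time := 3 * Polynomial.X + 4
  outputsFun w :=
    { steps := (exists_run w (none, none, none)).choose
      evals_in_steps := by
        have h := (exists_run w (none, none, none)).choose_spec.2
        have h₀ : initList machine (w.map (Equiv.refl Symbol).invFun) =
            ⟨some .reverse, (none, none, none), contents w [] [] []⟩ := by
          refine congrArg (TM2.Cfg.mk _ _) (funext fun k => ?_)
          cases k
          · exact List.map_id w
          all_goals rfl
        have h₁ : haltList machine ((Computability.encodeBool (decideComplete w)).map
            (Equiv.refl Bool).invFun) =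
            ⟨none, (none, none, none), contents [] [] [] [decideComplete w]⟩ := by
          refine congrArg (TM2.Cfg.mk _ _) (funext fun k => ?_)
          cases k <;> rfl
        exact (congrArg (run _) (congrArg some h₀)).trans (h.trans (congrArg some h₁.symm))
      steps_le_m := by
        simpa using (exists_run w (none, none, none)).choose_spec.1 }

end CompletenessMachine

theorem inP_variableFreeCompleteness {l : ModalLogic} (hl : l = K5 ∨ l = K45) :
    InP (variableFreeCompleteness l) := by
  refine ⟨decideComplete, decideComplete_iff hl, CompletenessMachine.computable, ?_⟩
  intro k
  change Finite (CompletenessMachine.Alphabet k)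
  cases k <;> infer_instance

end ModalCompleteness

open ModalCompleteness ModalCompleteness.KripkeModel
theorem mainTheorem11 (l : ModalLogic) (hl : l = K5 ∨ l = K45) :
    (irreflexivePoint.IsModelFor l ∧ reflexivePoint.IsModelFor l ∧
      ¬ Bisimilar ∅ irreflexivePoint () reflexivePoint () ∧
      ∀ M : KripkeModel.{u}, M.IsModelFor l → ∀ a : M.World,
        (Bisimilar ∅ M a irreflexivePoint () ↔ ¬ ∃ b, M.Rel a b) ∧
        (Bisimilar ∅ M a reflexivePoint () ↔ ∃ b, M.Rel a b)) ∧
    (∀ φ : Formula, φ.vars = ∅ →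
      (Complete l φ ↔ ¬ (irreflexivePoint.Sat () φ ∧ reflexivePoint.Sat () φ))) ∧
    InP (variableFreeCompleteness l) := by
  have h₀ := irreflexivePoint_isModelFor hl
  refine ⟨⟨h₀, reflexivePoint_isModelFor hl, fun h => ?_, fun M hM a =>
    ⟨bisimilar_irreflexivePoint_iff M a, bisimilar_reflexivePoint_iff (hM _ (five_mem hl)) a⟩⟩,
    fun φ hφ => complete_iff_of_vars_eq_empty hl hφ, inP_variableFreeCompleteness hl⟩
  obtain ⟨_, hb⟩ := (bisimilar_reflexivePoint_iff (h₀ _ (five_mem hl)) ()).1 h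
  exact hb
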